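/- **Model.** The adversarial CONGEST model on an $n$-node simple graph $G=(V,E)$: nodes have unique $O(\log n)$-bit identifiers and communicate in synchronous rounds; in each round each node may send a (possibly different) $O(\log n)$-bit message to each neighbour. Local computation is free, and each node has private independent uniform random bits. Initially a node knows only its own identifier, the identifiers of its neighbours, a polynomial estimate $N$ of $n$ (that is, $n\le N^{a}$ and $N\le n^{a}$ for a constant $a$), the bound $t$, and a linear estimate $\psi$ of the expansion parameter $\phi$ (that is, $\phi\le b\psi$ and $\psi\le b\phi$ for a constant $b$). A computationally unbounded adversary controls a fixed set $F\subseteq E$ of at most $t$ edges, unknown to the nodes. It knows the graph, the protocol, the inputs and all random bits of the nodes, and in each round, depending on all messages sent in the network so far, it decides which $O(\log n)$-bit message (if any) is delivered on each edge of $F$, separately in each direction. In the broadcast task a source node $s$ holds an $O(\log n)$-bit message $m_0$, and every node has to output $m_0$. **Expanders.** For $S\subseteq V$ let $\delta_G(S)$ be the number of edges between $S$ and $V\setminus S$, and $\mathrm{vol}_G(S)$ the number of edges incident to $S$. $G$ is a $\phi$-expander if $\delta_G(S)\ge\phi\cdot\min\{\mathrm{vol}_G(S),\mathrm{vol}_G(V\setminus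 S)\}$ for every $S\subseteq V$ such that $S$ and $V\setminus S$ have positive volume. **Theorem 3.** For all constants $a\ge 1$ (governing the estimate of $n$ and the lengths of identifiers and of $m_0$), $b\ge 1$ and $c\ge 0$ there are constants $C,K>0$, a message-size bound of $O(\log n)$ bits and a randomized algorithm, which depends on $N$, $t$ and $\psi$ but not on the graph, such that the following holds for all $n\ge 2$, $t\ge 1$ and $\phi>0$. On every $n$-node $\phi$-expander $G$ with minimum degree at least $C\,t^2\log n/\phi$, the algorithm runs for at most $K\,t\log^2 n/\phi$ rounds and, for every assignment of identifiers, every source $s$, every message $m_0$, every set $F\subseteq E$ with $|F|\le t$ and every adversary strategy controlling $F$, with probability at least $1-n^{-c}$ all nodes output $m_0$. -/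

import Mathlib

namespace AdvCongest

/-! ### Expander graphs -/

section Expander

variable {V : Type*} [Fintype V] [DecidableEq V] (G : SimpleGraph V) [DecidableRel G.Adj]

/-- The number of edges of `G` with one endpoint in `S` and the other one outside `S`. -/
def cutSize (S : Finset V) : ℕ :=
  (G.edgeFinset.filter fun e => (∃ u ∈ S, u ∈ e) ∧ ∃ v ∈ Sᶜ, v ∈ e).card

/-- The volume of `S`: the number of edges of `G` incident to `S`. -/
def vol (S : Finset V) : ℕ :=
  (G.edgeFinset.filter fun e => ∃ v ∈ S, v ∈ e).card

/-- The conductance of a cut (meaningful when both sides have positive volume). -/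
noncomputable def conductance (S : Finset V) : ℝ :=
  (cutSize G S : ℝ) / (min (vol G S) (vol G Sᶜ) : ℕ)

/-- `G` is a `φ`-expander: every cut with two sides of positive volume has conductance at
least `φ`. -/
def IsExpander (φ : ℝ) : Prop :=
  ∀ S : Finset V, 0 < vol G S → 0 < vol G Sᶜ → φ ≤ conductance G S

end Expander

/-! ### The adversarial CONGEST model -/

/-- Bit strings of length `k`. -/
abbrev Bits (k : ℕ) : Type := Fin k → Bool

/-- What a node knows about the instance at the start: its own identifier, the identifiers of its
neighbours, and the broadcast message if it is the source (`none` at every other node). -/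
structure LocalInput (idLen msgLen : ℕ) where
  ownId : Bits idLen
  nbrIds : Finset (Bits idLen)
  source : Option (Bits msgLen)

/-- A randomized synchronous message-passing algorithm, given as the program that every node runs.
Identifiers have `idLen` bits, the broadcast message has `msgLen` bits, and in each round a node
sends to each neighbour one message of `bw` bits, or nothing (`none`). Local computation is
unrestricted, and each node has `coinLen` private random bits. -/
structure Algorithm (idLen msgLen bw : ℕ) where
  /-- local states of a node -/
  State : Type
  /-- number of random bits of a node -/
  coinLen : ℕ
  /-- number of communication rounds, after which every node produces its output -/
  rounds : ℕ
  /-- initial state, from the local input and the node's own random bits -/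
  init : LocalInput idLen msgLen → Bits coinLen → State
  /-- message to be sent in the current round to the neighbour with a given identifier -/
  send : State → Bits idLen → Option (Bits bw)
  /-- new state, from the messages received in the current round, indexed by the identifier of
  the neighbour at the other end of the edge -/
  step : State → (Bits idLen → Option (Bits bw)) → State
  /-- output of a node -/
  output : State → Option (Bits msgLen)

/-- A table of messages, one (or none) for each ordered pair (sender, receiver). -/
abbrev Traffic (V : Type*) (bw : ℕ) := V → V → Option (Bits bw)

/-- The strategy of an adaptive, computationally unbounded adversary. From the random bits of all
the nodes and the list of all messages that the nodes have sent in the network up to and including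
the current round (oldest first), it determines the messages that it puts on the edges it controls,
separately for each direction. -/
abbrev Strategy (V : Type*) (coinLen bw : ℕ) :=
  (V → Bits coinLen) → List (Traffic V bw) → Traffic V bw

section Execution

variable {V : Type*} [Fintype V] [DecidableEq V] (G : SimpleGraph V) [DecidableRel G.Adj]
  {idLen msgLen bw : ℕ} (id : V → Bits idLen)

/-- The local input of node `v` when `s` is the source and `m₀` its message. -/
def localInput (s : V) (m₀ : Bits msgLen) (v : V) : LocalInput idLen msgLen where
  ownId := id v
  nbrIds := (G.neighborFinset v).image id
  source := if v = s then some m₀ else none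

/-- The messages that the nodes send along the edges of `G` when they are in the states `σ`. -/
def sent (A : Algorithm idLen msgLen bw) (σ : V → A.State) : Traffic V bw :=
  fun u v => if G.Adj u v then A.send (σ u) (id v) else none

/-- The messages that arrive: on the edges of `F` those of the adversary, on all other edges those
that were sent. -/
def delivered (F : Finset (Sym2 V)) (honest adversarial : Traffic V bw) : Traffic V bw :=
  fun u v => if s(u, v) ∈ F then adversarial u v else honest u v

/-- The messages that `v` receives, indexed by the identifiers of the senders. -/
noncomputable def inbox (d : Traffic V bw) (v : V) : Bits idLen → Option (Bits bw) :=
  Function.extend id (fun u => d u v) (fun _ => none)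

/-- The states of all nodes after `r` rounds, with the messages that the nodes sent in these
rounds. -/
noncomputable def run (A : Algorithm idLen msgLen bw) (s : V) (m₀ : Bits msgLen)
    (F : Finset (Sym2 V)) (adv : Strategy V A.coinLen bw) (ω : V → Bits A.coinLen) :
    ℕ → (V → A.State) × List (Traffic V bw)
  | 0 => (fun v => A.init (localInput G id s m₀ v) (ω v), [])
  | r + 1 =>
    let σ := (run A s m₀ F adv ω r).1
    let hist := (run A s m₀ F adv ω r).2 ++ [sent G id A σ]
    let d := delivered F (sent G id A σ) (adv ω hist)
    (fun v => A.step (σ v) (inbox id d v), hist)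

/-- At the end of the execution every node outputs the message of the source. -/
def BroadcastSucceeds (A : Algorithm idLen msgLen bw) (s : V) (m₀ : Bits msgLen)
    (F : Finset (Sym2 V)) (adv : Strategy V A.coinLen bw) (ω : V → Bits A.coinLen) : Prop :=
  ∀ v, A.output ((run G id A s m₀ F adv ω A.rounds).1 v) = some m₀

/-- The probability that the broadcast succeeds, when the random bits of the nodes are independent
and uniform. -/
noncomputable def successProb (A : Algorithm idLen msgLen bw) (s : V) (m₀ : Bits msgLen)
    (F : Finset (Sym2 V)) (adv : Strategy V A.coinLen bw) : ℝ :=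
  (ProbabilityTheory.uniformOn (Set.univ : Set (V → Bits A.coinLen))).real
    {ω | BroadcastSucceeds G id A s m₀ F adv ω}

end Execution

end AdvCongest

/-!
Every node privately assigns to each of its neighbors one of `Q = Θ(t)` random colors, and each
color `k` floods `m₀` along the edges `uv` for which `v` gave `u` the color `k`. The `t` controlled
edges carry at most `2t` colors, so if flooding in every color would reach all nodes over honest
edges, the majority of the colors decides for `m₀`.

Suppose that from a set `S` the color `k` leads only into a set `H` whose degree sum is at most half
the cut of `S`. Then at least half of the cut edges end outside `S ∪ H`, and none of them may have
the color `k`. There are `Ω(φ d (min(|S|, |Sᶜ|) + |H|))` such edges, where `d` is the minimum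
degree, so this happens with probability `exp(-Ω(φ d / Q) (min(|S|, |Sᶜ|) + |H|))`. When `φ d / Q`
exceeds a large multiple of `log n`, this is small enough for a union bound over all `S` and `H`.

Outside of this event, a phase in which every color has its turn raises the degree sum `f` of the
flooded set by at least `(φ / 4) min(f, M - f)`, where `M` is the degree sum of the graph. This
multiplies the odds `f / (M - f)` by at least `1 + φ / 4`, so `O(log n / φ)` phases suffice.
-/

namespace AdvCongest

open Finset Function MeasureTheory ProbabilityTheory

lemma one_le_two_mul_log {n : ℕ} (hn : 2 ≤ n) : 1 ≤ 2 * Real.log n := by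
  have := Real.log_le_log two_pos (by exact_mod_cast hn : (2 : ℝ) ≤ n)
  linarith [Real.log_two_gt_d9]

lemma card_filter_mem_sym2_le_two {α : Type*} [DecidableEq α] (S : Finset α) (e : Sym2 α) :
    #{v ∈ S | v ∈ e} ≤ 2 :=
  calc #{v ∈ S | v ∈ e} ≤ #e.toFinset := card_le_card fun v hv ↦ by simp_all
    _ ≤ 2 := by rw [Sym2.card_toFinset]; split_ifs <;> simp

section DegSum

variable {V : Type*} [Fintype V] (G : SimpleGraph V) [DecidableRel G.Adj]

/-- The sum of the degrees of the vertices in `S`. It measures the size of the flooded set: within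
a factor of two it agrees with `vol`, but unlike `vol` it is additive. -/
def degSum (S : Finset V) : ℕ := ∑ v ∈ S, G.degree v

lemma degSum_mono {S T : Finset V} (h : S ⊆ T) : degSum G S ≤ degSum G T :=
  sum_le_sum_of_subset h

lemma minDegree_mul_card_le_degSum (S : Finset V) : G.minDegree * #S ≤ degSum G S := by
  rw [mul_comm, ← smul_eq_mul]
  exact card_nsmul_le_sum _ _ _ fun v _ ↦ G.minDegree_le_degree v

variable {G} in
lemma degSum_pos (hd : 0 < G.minDegree) {S : Finset V} (hS : S.Nonempty) : 0 < degSum G S :=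
  (Nat.mul_pos hd hS.card_pos).trans_le (minDegree_mul_card_le_degSum G S)

lemma degSum_univ_le_sq_card : degSum G univ ≤ Fintype.card V ^ 2 := by
  rw [sq, ← smul_eq_mul]
  exact sum_le_card_nsmul _ _ _ fun v _ ↦ (G.degree_lt_card_verts v).le

lemma card_interedges_le_degSum (S T : Finset V) : #(G.interedges S T) ≤ degSum G T := by
  rw [G.interedges_def, card_filter, sum_product_right]
  refine sum_le_sum fun v _ ↦ ?_
  rw [← card_filter, ← G.card_neighborFinset_eq_degree]
  exact card_le_card fun u hu ↦ (G.mem_neighborFinset v u).2 (mem_filter.1 hu).2.symm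

variable [DecidableEq V]

lemma degSum_add_degSum_compl (S : Finset V) : degSum G S + degSum G Sᶜ = degSum G univ :=
  sum_add_sum_compl S _

lemma degSum_le_two_mul_vol (S : Finset V) : degSum G S ≤ 2 * vol G S := by
  set E : Finset (Sym2 V) := {e ∈ G.edgeFinset | ∃ v ∈ S, v ∈ e}
  calc degSum G S = ∑ v ∈ S, #{e ∈ E | v ∈ e} := sum_congr rfl fun v hv ↦ by
        rw [← G.card_incidenceFinset_eq_degree, G.incidenceFinset_eq_filter, filter_filter]
        congr! 3 with e
        exact ⟨fun h ↦ ⟨⟨v, hv, h⟩, h⟩, And.right⟩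
    _ = ∑ e ∈ E, #{v ∈ S | v ∈ e} := sum_card_bipartiteAbove_eq_sum_card_bipartiteBelow _
    _ ≤ #E * 2 := sum_le_card_nsmul _ _ _ fun e _ ↦ card_filter_mem_sym2_le_two S e
    _ = 2 * vol G S := mul_comm _ _

variable {G} in
lemma vol_pos (hd : 0 < G.minDegree) {S : Finset V} (hS : S.Nonempty) : 0 < vol G S := by
  have := degSum_pos hd hS
  have := degSum_le_two_mul_vol G S
  omega

lemma card_interedges_compl_le (S H : Finset V) :
    #(G.interedges S Sᶜ) ≤ #(G.interedges S (S ∪ H)ᶜ) + degSum G H := by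
  have hsub : G.interedges S Sᶜ ⊆ G.interedges S (S ∪ H)ᶜ ∪ G.interedges S H := by
    intro p hp
    simp only [mem_union, G.mem_interedges_iff, mem_compl] at hp ⊢
    tauto
  calc #(G.interedges S Sᶜ) ≤ #(G.interedges S (S ∪ H)ᶜ) + #(G.interedges S H) :=
        (card_le_card hsub).trans (card_union_le _ _)
    _ ≤ _ := by gcongr; exact card_interedges_le_degSum G S H

lemma cutSize_le_card_interedges (S : Finset V) : cutSize G S ≤ #(G.interedges S Sᶜ) := by
  refine (card_le_card (t := (G.interedges S Sᶜ).image fun p ↦ s(p.1, p.2)) ?_).trans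
    card_image_le
  intro e he
  simp only [mem_filter, SimpleGraph.mem_edgeFinset] at he
  obtain ⟨he, ⟨u, hu, hue⟩, v, hv, hve⟩ := he
  obtain rfl : e = s(u, v) :=
    (Sym2.mem_and_mem_iff (ne_of_mem_of_not_mem hu (mem_compl.1 hv))).1 ⟨hue, hve⟩
  exact mem_image.2 ⟨(u, v), G.mem_interedges_iff.2 ⟨hu, hv, he⟩, rfl⟩

lemma conductance_le_one (S : Finset V) : conductance G S ≤ 1 := by
  refine div_le_one_of_le₀ (Nat.cast_le.2 (le_min ?_ ?_)) (Nat.cast_nonneg _) <;>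
    refine card_le_card (monotone_filter_right _ fun e _ he ↦ ?_)
  exacts [he.1, he.2]

end DegSum

section Expander

variable {V : Type*} [Fintype V] [DecidableEq V] {G : SimpleGraph V} [DecidableRel G.Adj] {φ : ℝ}

lemma IsExpander.le_one [Nonempty V] (hG : IsExpander G φ) (hd : 0 < G.minDegree) : φ ≤ 1 := by
  inhabit V
  obtain ⟨w, hw⟩ := (G.degree_pos_iff_exists_adj default).1 (hd.trans_le (G.minDegree_le_degree _))
  exact (hG {default} (vol_pos hd (singleton_nonempty _))
    (vol_pos hd ⟨w, by simpa using hw.ne'⟩)).trans (conductance_le_one G _)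

lemma IsExpander.mul_min_degSum_le (hG : IsExpander G φ) (hφ : 0 ≤ φ) (hd : 0 < G.minDegree)
    {S : Finset V} (hS : S.Nonempty) (hS' : Sᶜ.Nonempty) :
    φ * (min (degSum G S) (degSum G Sᶜ) : ℕ) ≤ 2 * #(G.interedges S Sᶜ) := by
  have hvol : 0 < min (vol G S) (vol G Sᶜ) := lt_min (vol_pos hd hS) (vol_pos hd hS')
  have hmin : min (degSum G S) (degSum G Sᶜ) ≤ 2 * min (vol G S) (vol G Sᶜ) := by
    have := degSum_le_two_mul_vol G S
    have := degSum_le_two_mul_vol G Sᶜ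
    omega
  calc φ * (min (degSum G S) (degSum G Sᶜ) : ℕ)
      ≤ φ * (2 * min (vol G S) (vol G Sᶜ) : ℕ) := by gcongr
    _ = 2 * (φ * (min (vol G S) (vol G Sᶜ) : ℕ)) := by push_cast; ring
    _ ≤ 2 * cutSize G S := by
        gcongr
        exact (le_div_iff₀ (Nat.cast_pos.2 hvol)).1 (hG S (vol_pos hd hS) (vol_pos hd hS'))
    _ ≤ 2 * #(G.interedges S Sᶜ) := by gcongr; exact cutSize_le_card_interedges G S

lemma IsExpander.mul_min_card_add_card_le (hG : IsExpander G φ) (hφ : 0 ≤ φ)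
    (hd : 0 < G.minDegree) {S H : Finset V} (hS : S.Nonempty) (hS' : Sᶜ.Nonempty)
    (hH : 2 * degSum G H ≤ #(G.interedges S Sᶜ)) :
    φ * G.minDegree * (min (#S) (#Sᶜ) + #H : ℕ) ≤ 5 * #(G.interedges S (S ∪ H)ᶜ) := by
  have : Nonempty V := hS.to_type
  have hcut : (#(G.interedges S Sᶜ) : ℝ) ≤ #(G.interedges S (S ∪ H)ᶜ) + degSum G H := by
    exact_mod_cast card_interedges_compl_le G S H
  have hH : 2 * (degSum G H : ℝ) ≤ #(G.interedges S Sᶜ) := by exact_mod_cast hH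
  have hmin : φ * (G.minDegree * min (#S) (#Sᶜ) : ℕ) ≤ 2 * #(G.interedges S Sᶜ) := by
    refine le_trans ?_ (hG.mul_min_degSum_le hφ hd hS hS')
    gcongr
    rw [← Nat.mul_min_mul_left]
    exact min_le_min (minDegree_mul_card_le_degSum G S) (minDegree_mul_card_le_degSum G Sᶜ)
  have hcard : φ * (G.minDegree * #H : ℕ) ≤ degSum G H :=
    (mul_le_of_le_one_left (Nat.cast_nonneg _) (hG.le_one hd)).trans
      (by exact_mod_cast minDegree_mul_card_le_degSum G H)
  push_cast at hmin hcard ⊢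
  linarith

end Expander

section LogisticGrowth

lemma one_add_mul_sub_mul_le_of_add_mul_min_le {x y M ε : ℝ} (hε : 0 ≤ ε) (hx : 0 ≤ x)
    (hxM : x ≤ M) (hxy : x + ε * min x (M - x) ≤ y) :
    (1 + ε) * (M - y) * x ≤ (M - x) * y := by
  have hmin : x * (M - x) ≤ M * min x (M - x) := by
    rw [← min_mul_max x (M - x), mul_comm M]
    exact mul_le_mul_of_nonneg_left (max_le hxM (by linarith)) (le_min hx (by linarith))
  have hmono : 0 ≤ ((1 + ε) * x + (M - x)) * (y - (x + ε * min x (M - x))) :=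
    mul_nonneg (by nlinarith) (by linarith)
  have hmin' : ε * (x * (M - x)) ≤ ε * (M * min x (M - x)) := by gcongr
  have hsq : 0 ≤ ε ^ 2 * (x * min x (M - x)) :=
    mul_nonneg (sq_nonneg ε) (mul_nonneg hx (le_min hx (by linarith)))
  linarith

variable {f : ℕ → ℝ} {M ε : ℝ}

/-- The odds `f j / (M - f j)` grow at least geometrically with ratio `1 + ε`. -/
lemma one_add_pow_mul_sub_le_of_add_mul_min_le (hε : 0 ≤ ε) (h0 : 1 ≤ f 0) (hM : ∀ j, f j ≤ M)
    (hf : ∀ j, f j + ε * min (f j) (M - f j) ≤ f (j + 1)) (j : ℕ) :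
    (1 + ε) ^ j * (M - f j) ≤ M * f j := by
  have hpos (j : ℕ) : 0 < f j := by
    induction j with
    | zero => linarith
    | succ j ih =>
      have : 0 ≤ ε * min (f j) (M - f j) := mul_nonneg hε (le_min ih.le (by linarith [hM j]))
      linarith [hf j]
  induction j with
  | zero => nlinarith [hM 0]
  | succ j ih =>
    refine le_of_mul_le_mul_right ?_ (hpos j)
    calc (1 + ε) ^ (j + 1) * (M - f (j + 1)) * f j
        = (1 + ε) ^ j * ((1 + ε) * (M - f (j + 1)) * f j) := by ring
      _ ≤ (1 + ε) ^ j * ((M - f j) * f (j + 1)) := by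
          gcongr (1 + ε) ^ j * ?_
          exact one_add_mul_sub_mul_le_of_add_mul_min_le hε (hpos j).le (hM j) (hf j)
      _ = (1 + ε) ^ j * (M - f j) * f (j + 1) := by ring
      _ ≤ M * f j * f (j + 1) := by gcongr; exact (hpos _).le
      _ = M * f (j + 1) * f j := by ring

lemma sub_lt_one_of_add_mul_min_le (hε : 0 ≤ ε) (hε' : ε ≤ 1) (h0 : 1 ≤ f 0)
    (hM : ∀ j, f j ≤ M) (hf : ∀ j, f j + ε * min (f j) (M - f j) ≤ f (j + 1)) {E : ℕ}
    (hE : 4 * Real.log M < ε * E) : M - f E < 1 := by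
  have hM1 : 1 ≤ M := h0.trans (hM 0)
  have hlog : ε / 2 ≤ Real.log (1 + ε) := by
    refine le_trans ?_ (Real.le_log_one_add_of_nonneg hε)
    rw [div_le_div_iff₀ two_pos (by linarith)]
    nlinarith
  have hpow : M ^ 2 < (1 + ε) ^ E := by
    rw [← Real.log_lt_log_iff (by positivity) (by positivity), Real.log_pow, Real.log_pow]
    push_cast
    nlinarith [mul_le_mul_of_nonneg_left hlog (Nat.cast_nonneg (α := ℝ) E)]
  have hodds := one_add_pow_mul_sub_le_of_add_mul_min_le hε h0 hM hf E
  by_contra! hge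
  have : M * f E ≤ M ^ 2 := by rw [sq]; gcongr; exact hM E
  nlinarith

end LogisticGrowth

section Spreading

variable {V : Type*} [Fintype V] [DecidableEq V] (G : SimpleGraph V) [DecidableRel G.Adj]
  (R : V → V → Prop)

open scoped Classical in
/-- The vertices outside `S` that are reached from `S` by an edge `uv` of `G` with `R u v`, where
`R u v` means that `v` takes over what `u` sends. -/
noncomputable def newNeighbors (S : Finset V) : Finset V := {v ∈ Sᶜ | ∃ u ∈ S, G.Adj u v ∧ R u v}

/-- Every cut is crossed along `R` into a set of vertices whose degree sum is more than half the
size of the cut. This is the expansion that flooding along `R` needs. -/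
def IsSpreading : Prop :=
  ∀ S : Finset V, S.Nonempty → Sᶜ.Nonempty →
    #(G.interedges S Sᶜ) < 2 * degSum G (newNeighbors G R S)

variable {G R}

lemma newNeighbors_subset_iff {S H : Finset V} :
    newNeighbors G R S ⊆ H ↔ ∀ p ∈ G.interedges S (S ∪ H)ᶜ, ¬ R p.1 p.2 := by
  simp only [newNeighbors, subset_iff, mem_filter, mem_compl, Prod.forall,
    G.mk_mem_interedges_iff, mem_union]
  grind

lemma disjoint_newNeighbors (S : Finset V) : Disjoint S (newNeighbors G R S) :=
  disjoint_compl_right.mono_right (by classical exact filter_subset _ _)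

lemma IsSpreading.degSum_add_mul_min_le (hR : IsSpreading G R) {φ : ℝ} (hφ : 0 ≤ φ)
    (hG : IsExpander G φ) (hd : 0 < G.minDegree) {S : Finset V} (hS : S.Nonempty) :
    degSum G S + φ / 4 * min (degSum G S : ℝ) (degSum G univ - degSum G S)
      ≤ degSum G (S ∪ newNeighbors G R S) := by
  have hcompl : (degSum G univ : ℝ) - degSum G S = degSum G Sᶜ := by
    rw [← degSum_add_degSum_compl G S]; push_cast; ring
  have hunion : degSum G (S ∪ newNeighbors G R S) = degSum G S + degSum G (newNeighbors G R S) :=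
    sum_union (disjoint_newNeighbors S)
  rw [hcompl, hunion, ← Nat.cast_min, Nat.cast_add]
  gcongr
  rcases Sᶜ.eq_empty_or_nonempty with hS' | hS'
  · have hmin : min (degSum G S) (degSum G Sᶜ) = 0 := by simp [hS', degSum]
    simp [hmin]
  · have hexp := hG.mul_min_degSum_le hφ hd hS hS'
    have hspread : (#(G.interedges S Sᶜ) : ℝ) < 2 * degSum G (newNeighbors G R S) := by
      exact_mod_cast hR S hS hS'
    linarith

lemma IsSpreading.eq_univ (hR : IsSpreading G R) {φ : ℝ} (hφ : 0 < φ) (hG : IsExpander G φ)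
    (hd : 0 < G.minDegree) {S : ℕ → Finset V} (h0 : (S 0).Nonempty)
    (hS : ∀ j, S j ∪ newNeighbors G R (S j) ⊆ S (j + 1)) {E : ℕ}
    (hE : 32 * Real.log (Fintype.card V) / φ < E) : S E = univ := by
  have : Nonempty V := h0.to_type
  have hne (j : ℕ) : (S j).Nonempty := by
    induction j with
    | zero => exact h0
    | succ j ih => exact ih.mono (union_subset_left (hS j))
  have hgrowth (j : ℕ) : degSum G (S j) + φ / 4 * min (degSum G (S j) : ℝ)
      (degSum G univ - degSum G (S j)) ≤ degSum G (S (j + 1)) :=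
    (hR.degSum_add_mul_min_le hφ.le hG hd (hne j)).trans (by gcongr; exact degSum_mono G (hS j))
  have hlog : Real.log (degSum G univ) ≤ 2 * Real.log (Fintype.card V) := by
    rw [← Nat.cast_two, ← Real.log_pow]
    exact Real.log_le_log (by exact_mod_cast degSum_pos hd univ_nonempty)
      (by exact_mod_cast degSum_univ_le_sq_card G)
  have hlt : (degSum G univ : ℝ) - degSum G (S E) < 1 :=
    sub_lt_one_of_add_mul_min_le (f := fun j ↦ (degSum G (S j) : ℝ)) (ε := φ / 4) (by positivity)
      (by linarith [hG.le_one hd]) (by exact_mod_cast degSum_pos hd h0)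
      (fun j ↦ by exact_mod_cast degSum_mono G (subset_univ _)) hgrowth
      (by rw [div_lt_iff₀ hφ] at hE; linarith)
  by_contra hne'
  have hpos := degSum_pos hd (nonempty_iff_ne_empty.2 (mt (compl_eq_empty_iff _).1 hne'))
  rw [← degSum_add_degSum_compl G (S E), Nat.cast_add, add_sub_cancel_left] at hlt
  exact hpos.ne' (Nat.lt_one_iff.1 (by exact_mod_cast hlt))

end Spreading

section Uniform

variable {Ω Ω' : Type*} [MeasurableSpace Ω] [MeasurableSingletonClass Ω] [MeasurableSpace Ω']
  [MeasurableSingletonClass Ω']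

lemma uniformOn_univ_real_preimage_equiv [Finite Ω] (e : Ω ≃ Ω') (s : Set Ω') :
    (uniformOn (Set.univ : Set Ω)).real (e ⁻¹' s) = (uniformOn (Set.univ : Set Ω')).real s := by
  cases nonempty_fintype Ω
  have := Fintype.ofEquiv Ω e
  have hcount : Measure.count (e ⁻¹' s) = Measure.count s := by
    rw [Measure.count_apply (Set.toFinite _).measurableSet,
      Measure.count_apply (Set.toFinite _).measurableSet]
    exact congrArg _ (Set.encard_preimage_of_bijective e.bijective s)
  rw [measureReal_def, measureReal_def, uniformOn_univ, uniformOn_univ, hcount,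
    Fintype.card_congr e]

lemma uniformOn_univ_real_compl_singleton [Fintype Ω] (k : Ω) :
    (uniformOn (Set.univ : Set Ω)).real {k}ᶜ = 1 - 1 / Fintype.card Ω := by
  have : Nonempty Ω := ⟨k⟩
  have := isProbabilityMeasure_uniformOn (Set.finite_univ (α := Ω)) Set.univ_nonempty
  rw [probReal_compl_eq_one_sub (measurableSet_singleton k), measureReal_def, uniformOn_univ,
    Measure.count_singleton, ENNReal.toReal_div, ENNReal.toReal_one, ENNReal.toReal_natCast]

lemma uniformOn_univ_real_forall_ne {ι : Type*} [Finite ι] [Fintype Ω] (P : Finset ι) (k : Ω) :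
    (uniformOn Set.univ).real {f : ι → Ω | ∀ i ∈ P, f i ≠ k}
      = (1 - 1 / Fintype.card Ω) ^ #P := by
  classical
  cases nonempty_fintype ι
  have : Nonempty Ω := ⟨k⟩
  have := isProbabilityMeasure_uniformOn (Set.finite_univ (α := Ω)) Set.univ_nonempty
  have hset : {f : ι → Ω | ∀ i ∈ P, f i ≠ k}
      = Set.univ.pi fun i ↦ if i ∈ P then {k}ᶜ else Set.univ := by
    ext f
    simp only [Set.mem_ofPred_eq, Set.mem_univ_pi]
    refine forall_congr' fun i ↦ ?_
    split_ifs with hi <;> simp [hi]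
  rw [← Set.pi_univ Set.univ, uniformOn_pi, hset, measureReal_def, Measure.pi_pi,
    ENNReal.toReal_prod]
  simp only [← measureReal_def, apply_ite, uniformOn_univ_real_compl_singleton, probReal_univ]
  rw [prod_ite_mem, univ_inter, prod_const]

lemma uniformOn_univ_real_forall_curry_ne_le {ι ι' : Type*} [Finite ι] [Finite ι'] [Fintype Ω]
    (P : Finset (ι × ι')) (k : Ω) :
    (uniformOn Set.univ).real {f : ι → ι' → Ω | ∀ p ∈ P, f p.1 p.2 ≠ k}
      ≤ Real.exp (-(#P / Fintype.card Ω)) :=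
  calc (uniformOn Set.univ).real {f : ι → ι' → Ω | ∀ p ∈ P, f p.1 p.2 ≠ k}
      = (uniformOn Set.univ).real {f : ι × ι' → Ω | ∀ p ∈ P, f p ≠ k} :=
        (uniformOn_univ_real_preimage_equiv (Equiv.curry ι ι' Ω) _).symm
    _ = (1 - 1 / Fintype.card Ω) ^ #P := uniformOn_univ_real_forall_ne P k
    _ ≤ Real.exp (-(1 / Fintype.card Ω)) ^ #P := by
        have : (1 : ℝ) ≤ Fintype.card Ω := by exact_mod_cast Fintype.card_pos_iff.2 ⟨k⟩
        have : 1 / (Fintype.card Ω : ℝ) ≤ 1 := div_le_one_of_le₀ this (by positivity)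
        gcongr
        exact Real.one_sub_le_exp_neg _
    _ = Real.exp (-(#P / Fintype.card Ω)) := by rw [← Real.exp_nat_mul]; ring_nf

end Uniform

section UnionBound

variable {V : Type*} [Fintype V]

lemma sum_pow_card_finset (z : ℝ) : ∑ H : Finset V, z ^ #H = (z + 1) ^ Fintype.card V := by
  simpa using Fintype.sum_pow_mul_eq_add_pow V z 1

lemma sum_pow_card_add_pow_card_compl_le [DecidableEq V] {z : ℝ} (hz : 0 ≤ z) :
    ∑ S : Finset V with S.Nonempty ∧ Sᶜ.Nonempty, (z ^ #S + z ^ #Sᶜ)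
      ≤ 2 * ((z + 1) ^ Fintype.card V - 1) := by
  have hcompl : ∑ S : Finset V with S.Nonempty ∧ Sᶜ.Nonempty, z ^ #Sᶜ
      = ∑ S : Finset V with S.Nonempty ∧ Sᶜ.Nonempty, z ^ #S :=
    sum_nbij' compl compl (by simp [and_comm]) (by simp [and_comm]) (by simp) (by simp) (by simp)
  have hsub : ∑ S : Finset V with S.Nonempty ∧ Sᶜ.Nonempty, z ^ #S ≤ ∑ S ∈ {∅}ᶜ, z ^ #S :=
    sum_le_sum_of_subset_of_nonneg
      (fun S hS ↦ by simpa using (mem_filter.1 hS).2.1.ne_empty) fun _ _ _ ↦ by positivity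
  have htotal := Fintype.sum_eq_add_sum_compl (∅ : Finset V) fun S ↦ z ^ #S
  rw [sum_pow_card_finset, card_empty, pow_zero] at htotal
  rw [sum_add_distrib, hcompl]
  linarith

lemma add_one_pow_le_one_add_two_mul {z : ℝ} {n : ℕ} (hz : 0 ≤ z) (hnz : n * z ≤ 1) :
    (z + 1) ^ n ≤ 1 + 2 * (n * z) := by
  have hnz0 : 0 ≤ n * z := by positivity
  have hexp := Real.abs_exp_sub_one_le (x := n * z) (by rwa [abs_of_nonneg hnz0])
  rw [abs_of_nonneg hnz0] at hexp
  calc (z + 1) ^ n ≤ Real.exp z ^ n := by gcongr; exact Real.add_one_le_exp z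
    _ = Real.exp (n * z) := (Real.exp_nat_mul _ _).symm
    _ ≤ 1 + 2 * (n * z) := by linarith [le_abs_self (Real.exp (n * z) - 1)]

end UnionBound

section RandomColors

variable {V I K : Type*}

/-- The relation "`v` takes over what `u` sends" for the color `k`, when `κ v w` is the color that
`v` has chosen for its neighbor with identifier `w`. -/
def Accepts (id : V → I) (κ : V → I → K) (k : K) (u v : V) : Prop := κ v (id u) = k

variable [Fintype V] [DecidableEq V] [Finite I] [Fintype K] [MeasurableSpace K]
  [MeasurableSingletonClass K] {G : SimpleGraph V} [DecidableRel G.Adj] {id : V → I}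

lemma real_newNeighbors_subset_le_exp (hid : Injective id) (k : K) (S H : Finset V) :
    (uniformOn Set.univ).real {κ : V → I → K | newNeighbors G (Accepts id κ k) S ⊆ H}
      ≤ Real.exp (-(#(G.interedges S (S ∪ H)ᶜ) / Fintype.card K)) := by
  classical
  set choice : V × V → V × I := fun p ↦ (p.2, id p.1)
  have hchoice : Injective choice := fun p p' h ↦
    Prod.ext (hid (Prod.ext_iff.1 h).2) (Prod.ext_iff.1 h).1
  rw [← card_image_of_injective _ hchoice]
  convert uniformOn_univ_real_forall_curry_ne_le ((G.interedges S (S ∪ H)ᶜ).image choice) k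
    using 4 with κ
  rw [newNeighbors_subset_iff, forall_mem_image]
  rfl

variable {φ γ : ℝ}

lemma IsExpander.real_newNeighbors_subset_le (hG : IsExpander G φ) (hφ : 0 ≤ φ)
    (hd : 0 < G.minDegree) (hid : Injective id) (k : K)
    (hγ : 5 * γ * Fintype.card K ≤ φ * G.minDegree) {S H : Finset V}
    (hS : S.Nonempty) (hS' : Sᶜ.Nonempty) (hH : 2 * degSum G H ≤ #(G.interedges S Sᶜ)) :
    (uniformOn Set.univ).real {κ : V → I → K | newNeighbors G (Accepts id κ k) S ⊆ H}
      ≤ (Real.exp (-γ) ^ #S + Real.exp (-γ) ^ #Sᶜ) * Real.exp (-γ) ^ #H := by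
  have hK : (0 : ℝ) < Fintype.card K := by exact_mod_cast Fintype.card_pos_iff.2 ⟨k⟩
  have hedges : (min (#S) (#Sᶜ) + #H : ℕ) * γ ≤ #(G.interedges S (S ∪ H)ᶜ) / Fintype.card K := by
    rw [le_div_iff₀ hK]
    have hmul : 5 * γ * Fintype.card K * (min (#S) (#Sᶜ) + #H : ℕ)
        ≤ φ * G.minDegree * (min (#S) (#Sᶜ) + #H : ℕ) := by gcongr
    linarith [hG.mul_min_card_add_card_le hφ hd hS hS' hH]
  calc (uniformOn Set.univ).real {κ : V → I → K | newNeighbors G (Accepts id κ k) S ⊆ H}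
      ≤ Real.exp (-(#(G.interedges S (S ∪ H)ᶜ) / Fintype.card K)) :=
        real_newNeighbors_subset_le_exp hid k S H
    _ ≤ Real.exp (-γ) ^ (min (#S) (#Sᶜ) + #H) := by
        rw [← Real.exp_nat_mul, Real.exp_le_exp]
        linarith
    _ = Real.exp (-γ) ^ min (#S) (#Sᶜ) * Real.exp (-γ) ^ #H := pow_add _ _ _
    _ ≤ (Real.exp (-γ) ^ #S + Real.exp (-γ) ^ #Sᶜ) * Real.exp (-γ) ^ #H := by
        gcongr
        rcases min_choice (#S) (#Sᶜ) with h | h <;> rw [h]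
        exacts [le_add_of_nonneg_right (by positivity), le_add_of_nonneg_left (by positivity)]

lemma IsExpander.real_not_isSpreading_le (hG : IsExpander G φ) (hφ : 0 ≤ φ)
    (hd : 0 < G.minDegree) (hid : Injective id) (k : K)
    (hγ : 5 * γ * Fintype.card K ≤ φ * G.minDegree) :
    (uniformOn Set.univ).real {κ : V → I → K | ¬ IsSpreading G (Accepts id κ k)}
      ≤ 2 * ((Real.exp (-γ) + 1) ^ Fintype.card V - 1) * (Real.exp (-γ) + 1) ^ Fintype.card V := by
  have : Nonempty K := ⟨k⟩
  have := isProbabilityMeasure_uniformOn (Set.finite_univ (α := V → I → K)) Set.univ_nonempty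
  set z := Real.exp (-γ)
  let cuts : Finset (Finset V) := {S | S.Nonempty ∧ Sᶜ.Nonempty}
  let pairs : Finset (Finset V × Finset V) :=
    {p ∈ cuts ×ˢ univ | 2 * degSum G p.2 ≤ #(G.interedges p.1 p.1ᶜ)}
  let blocked (p : Finset V × Finset V) : Set (V → I → K) :=
    {κ | newNeighbors G (Accepts id κ k) p.1 ⊆ p.2}
  have hsub : {κ : V → I → K | ¬ IsSpreading G (Accepts id κ k)} ⊆ ⋃ p ∈ pairs, blocked p := by
    intro κ hκ
    simp only [IsSpreading, Set.mem_ofPred_eq, not_forall, not_lt] at hκ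
    obtain ⟨S, hS, hS', hle⟩ := hκ
    exact Set.mem_iUnion₂.2 ⟨(S, newNeighbors G (Accepts id κ k) S), by simp_all [pairs, cuts],
      by simp [blocked]⟩
  have hblocked (p) (hp : p ∈ pairs) :
      (uniformOn Set.univ).real (blocked p) ≤ (z ^ #p.1 + z ^ #p.1ᶜ) * z ^ #p.2 := by
    simp only [pairs, cuts, mem_filter, mem_product, mem_univ, true_and, and_true] at hp
    exact hG.real_newNeighbors_subset_le hφ hd hid k hγ hp.1.1 hp.1.2 hp.2
  calc (uniformOn Set.univ).real {κ : V → I → K | ¬ IsSpreading G (Accepts id κ k)}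
      ≤ (uniformOn Set.univ).real (⋃ p ∈ pairs, blocked p) :=
        measureReal_mono hsub (measure_ne_top _ _)
    _ ≤ ∑ p ∈ pairs, (uniformOn Set.univ).real (blocked p) := measureReal_biUnion_finset_le _ _
    _ ≤ ∑ p ∈ pairs, (z ^ #p.1 + z ^ #p.1ᶜ) * z ^ #p.2 := sum_le_sum hblocked
    _ ≤ ∑ p ∈ cuts ×ˢ univ, (z ^ #p.1 + z ^ #p.1ᶜ) * z ^ #p.2 :=
        sum_le_sum_of_subset_of_nonneg (filter_subset _ _) fun _ _ _ ↦ by positivity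
    _ = (∑ S ∈ cuts, (z ^ #S + z ^ #Sᶜ)) * (z + 1) ^ Fintype.card V := by
        rw [← sum_pow_card_finset, sum_mul_sum, sum_product]
    _ ≤ 2 * ((z + 1) ^ Fintype.card V - 1) * (z + 1) ^ Fintype.card V := by
        gcongr
        exact sum_pow_card_add_pow_card_compl_le (by positivity)

lemma IsExpander.real_exists_not_isSpreading_le (hG : IsExpander G φ) (hφ : 0 ≤ φ)
    (hd : 0 < G.minDegree) (hid : Injective id)
    (hγ : 5 * γ * Fintype.card K ≤ φ * G.minDegree)
    (hz : Fintype.card V * Real.exp (-γ) ≤ 1) :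
    (uniformOn Set.univ).real {κ : V → I → K | ∃ k, ¬ IsSpreading G (Accepts id κ k)}
      ≤ 12 * Fintype.card K * Fintype.card V * Real.exp (-γ) := by
  set z := Real.exp (-γ)
  have hpow := add_one_pow_le_one_add_two_mul (Real.exp_pos (-γ)).le hz
  calc (uniformOn Set.univ).real {κ : V → I → K | ∃ k, ¬ IsSpreading G (Accepts id κ k)}
      = (uniformOn Set.univ).real (⋃ k, {κ : V → I → K | ¬ IsSpreading G (Accepts id κ k)}) := by
        rw [Set.ofPred_exists]
    _ ≤ ∑ k, (uniformOn Set.univ).real {κ : V → I → K | ¬ IsSpreading G (Accepts id κ k)} :=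
        measureReal_iUnion_fintype_le _
    _ ≤ ∑ _k : K, 2 * ((z + 1) ^ Fintype.card V - 1) * (z + 1) ^ Fintype.card V :=
        sum_le_sum fun k _ ↦ hG.real_not_isSpreading_le hφ hd hid k hγ
    _ ≤ ∑ _k : K, 2 * (2 * (Fintype.card V * z)) * 3 := by
        gcongr <;> linarith
    _ = 12 * Fintype.card K * Fintype.card V * z := by
        rw [sum_const, card_univ, nsmul_eq_mul]; ring

lemma IsExpander.real_exists_not_isSpreading_le_one_div_pow (hG : IsExpander G φ)
    (hφ : 0 ≤ φ) (hd : 0 < G.minDegree) (hid : Injective id) {c : ℕ} (hV : 2 ≤ Fintype.card V)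
    (hdeg : 5 * ((c + 6 : ℕ) * Real.log (Fintype.card V)) * Fintype.card K ≤ φ * G.minDegree) :
    (uniformOn Set.univ).real {κ : V → I → K | ∃ k, ¬ IsSpreading G (Accepts id κ k)}
      ≤ 1 / (Fintype.card V : ℝ) ^ c := by
  have : Nonempty V := Fintype.card_pos_iff.1 (two_pos.trans_le hV)
  set n := Fintype.card V
  have hn : (2 : ℝ) ≤ n := by exact_mod_cast hV
  have hlog : 1 ≤ 5 * ((c + 6 : ℕ) * Real.log n) := by
    have := one_le_two_mul_log hV
    push_cast
    nlinarith [Nat.cast_nonneg (α := ℝ) c]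
  have hK : (Fintype.card K : ℝ) ≤ φ * G.minDegree :=
    (le_mul_of_one_le_left (Nat.cast_nonneg _) hlog).trans hdeg
  have hKn : (Fintype.card K : ℝ) ≤ n :=
    calc (Fintype.card K : ℝ) ≤ φ * G.minDegree := hK
      _ ≤ 1 * G.minDegree := by gcongr; exact hG.le_one hd
      _ ≤ n := by rw [one_mul]; exact_mod_cast G.minDegree_lt_card.le
  have hexp : Real.exp (-((c + 6 : ℕ) * Real.log n)) = 1 / (n : ℝ) ^ (c + 6) := by
    rw [Real.exp_neg, Real.exp_nat_mul, Real.exp_log (by linarith), one_div]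
  have hpow : (12 : ℝ) ≤ (n : ℝ) ^ 4 :=
    calc (12 : ℝ) ≤ 2 ^ 4 := by norm_num
      _ ≤ (n : ℝ) ^ 4 := by gcongr
  have hle := hG.real_exists_not_isSpreading_le (K := K) hφ hd hid hdeg (by
    rw [hexp, mul_one_div]
    exact div_le_one_of_le₀ (le_self_pow₀ (by linarith) (by omega)) (by positivity))
  calc (uniformOn Set.univ).real {κ : V → I → K | ∃ k, ¬ IsSpreading G (Accepts id κ k)}
      ≤ 12 * Fintype.card K * n * (1 / (n : ℝ) ^ (c + 6)) := by rwa [hexp] at hle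
    _ ≤ (n : ℝ) ^ 4 * n * n * (1 / (n : ℝ) ^ (c + 6)) := by gcongr
    _ = 1 / (n : ℝ) ^ c := by field_simp; ring

end RandomColors

section CleanColors

variable {V I K : Type*}

/-- A color is clean if no edge in `F` has it, so that the adversary has no influence on what is
flooded in this color. -/
def IsClean (id : V → I) (F : Finset (Sym2 V)) (κ : V → I → K) (k : K) : Prop :=
  ∀ u v, s(u, v) ∈ F → ¬ Accepts id κ k u v

open scoped Classical in
lemma card_not_isClean_le [Fintype K] (id : V → I) (F : Finset (Sym2 V)) (κ : V → I → K) :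
    #{k | ¬ IsClean id F κ k} ≤ 2 * #F := by
  have hsub : ({k | ¬ IsClean id F κ k} : Finset K) ⊆
      F.biUnion fun e ↦ {κ e.out.1 (id e.out.2), κ e.out.2 (id e.out.1)} := by
    intro k hk
    simp only [mem_filter_univ, IsClean, not_forall, not_not] at hk
    obtain ⟨u, v, huv, rfl⟩ := hk
    refine mem_biUnion.2 ⟨s(u, v), huv, ?_⟩
    have hout : s(s(u, v).out.1, s(u, v).out.2) = s(u, v) := Quot.out_eq _
    rcases Sym2.eq_iff.1 hout with ⟨hu, hv⟩ | ⟨hu, hv⟩ <;> simp [hu, hv]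
  calc #{k | ¬ IsClean id F κ k}
      ≤ ∑ e ∈ F, #{κ e.out.1 (id e.out.2), κ e.out.2 (id e.out.1)} :=
        (card_le_card hsub).trans card_biUnion_le
    _ ≤ #F * 2 := sum_le_card_nsmul _ _ _ fun e _ ↦ card_le_two
    _ = 2 * #F := mul_comm _ _

end CleanColors

section Flooding

variable {V β : Type*} (G : SimpleGraph V) (R : V → V → Prop) (active : ℕ → Prop) (s : V) (m₀ : β)

/-- The values `x r v` that the vertices `v` hold after `r` rounds arise by flooding `m₀` from `s`
along the edges `uv` of `G` with `R u v`: values are never changed, they are only taken over along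
such edges, and in an active round every such edge leads to a vertex with a value if it starts
in one. -/
structure IsFlooding (x : ℕ → V → Option β) : Prop where
  zero_source : x 0 s = some m₀
  eq_of_zero {v m} : x 0 v = some m → m = m₀
  succ {r v m} : x r v = some m → x (r + 1) v = some m
  eq_some_or_exists {r v m} :
    x (r + 1) v = some m → x r v = some m ∨ ∃ u, G.Adj u v ∧ R u v ∧ x r u = some m
  isSome_succ {r u v} : active r → G.Adj u v → R u v → (x r u).isSome → (x (r + 1) v).isSome

variable {G R active s m₀} {x : ℕ → V → Option β}

lemma IsFlooding.eq_source (hx : IsFlooding G R active s m₀ x) {r : ℕ} {v : V} {m : β}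
    (h : x r v = some m) : m = m₀ := by
  induction r generalizing v with
  | zero => exact hx.eq_of_zero h
  | succ r ih =>
    rcases hx.eq_some_or_exists h with h | ⟨u, -, -, h⟩
    exacts [ih h, ih h]

lemma IsFlooding.eq_some_of_le (hx : IsFlooding G R active s m₀ x) {r r' : ℕ} (hr : r ≤ r') {v : V}
    (h : x r v = some m₀) : x r' v = some m₀ := by
  induction r', hr using Nat.le_induction with
  | base => exact h
  | succ r' _ ih => exact hx.succ ih

lemma IsFlooding.succ_eq_some (hx : IsFlooding G R active s m₀ x) {r : ℕ} (hr : active r) {u v : V}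
    (huv : G.Adj u v) (hR : R u v) (h : x r u = some m₀) : x (r + 1) v = some m₀ := by
  obtain ⟨m, hm⟩ := Option.isSome_iff_exists.1 (hx.isSome_succ hr huv hR (by simp [h]))
  rwa [hx.eq_source hm] at hm

lemma IsFlooding.eq_some_of_isSpreading [Fintype V] [DecidableEq V] [DecidableRel G.Adj]
    (hx : IsFlooding G R active s m₀ x) (hR : IsSpreading G R) {φ : ℝ} (hφ : 0 < φ)
    (hG : IsExpander G φ) (hd : 0 < G.minDegree) {T E : ℕ}
    (hactive : ∀ j, ∃ r, T * j ≤ r ∧ r < T * (j + 1) ∧ active r)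
    (hE : 32 * Real.log (Fintype.card V) / φ < E) (v : V) : x (T * E) v = some m₀ := by
  classical
  let S (j : ℕ) : Finset V := {v | x (T * j) v = some m₀}
  have hS (j : ℕ) : S j ∪ newNeighbors G R (S j) ⊆ S (j + 1) := by
    obtain ⟨r, hjr, hrj, hr⟩ := hactive j
    intro v hv
    rw [mem_filter_univ]
    rcases mem_union.1 hv with hv | hv
    · exact hx.eq_some_of_le (hjr.trans hrj.le) ((mem_filter_univ v).1 hv)
    · obtain ⟨u, hu, huv, hRuv⟩ := (mem_filter.1 hv).2
      exact hx.eq_some_of_le hrj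
        (hx.succ_eq_some hr huv hRuv (hx.eq_some_of_le hjr ((mem_filter_univ u).1 hu)))
  have huniv : S E = univ :=
    hR.eq_univ hφ hG hd ⟨s, by simpa [S] using hx.zero_source⟩ hS hE
  exact (mem_filter_univ v).1 (huniv ▸ mem_univ v)

end Flooding

section Algorithm

/-- Encoding of the choice of one of `2 ^ q` colors for each identifier by random bits. -/
noncomputable def coinEquiv (idLen q : ℕ) :
    Bits (2 ^ idLen * q) ≃ (Bits idLen → Fin (2 ^ q)) :=
  Fintype.equivOfCardEq (by simp [← pow_mul, mul_comm])

/-- The color that is flooded in round `r`. -/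
def activeColor (q r : ℕ) : Fin (2 ^ q) := ⟨r % 2 ^ q, Nat.mod_lt _ (Nat.two_pow_pos q)⟩

/-- The state of a node in the flooding algorithm: the number of elapsed rounds, the color that the
node assigns to each sender, and for each color the value accepted so far. -/
structure FloodState (idLen msgLen q : ℕ) where
  round : ℕ
  color : Bits idLen → Fin (2 ^ q)
  val : Fin (2 ^ q) → Option (Bits msgLen)

open scoped Classical in
/-- A value received from some sender in `P`, if there is one. -/
noncomputable def accepted {ι β : Type*} (P : ι → Prop) (received : ι → Option β) : Option β :=
  if h : ∃ m w, P w ∧ received w = some m then some h.choose else none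

open scoped Classical in
/-- The value held in more than half of the places, if there is one. -/
noncomputable def majority {ι β : Type*} [Fintype ι] [DecidableEq β] (val : ι → Option β) :
    Option β :=
  if h : ∃ m, Fintype.card ι < 2 * #{i | val i = some m} then some h.choose else none

/-- Each node privately assigns a random color to each of its neighbors. In each of the phases the
colors take turns. In the round of a color every node sends the value that it holds for this color,
and a node without such a value accepts one from the neighbors to which it assigned the color. At
the end each node outputs the value that it holds for the majority of the colors. -/
noncomputable def floodAlgorithm (idLen msgLen q phases : ℕ) : Algorithm idLen msgLen msgLen where
  State := FloodState idLen msgLen q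
  coinLen := 2 ^ idLen * q
  rounds := 2 ^ q * phases
  init x ω := ⟨0, coinEquiv idLen q ω, fun _ ↦ x.source⟩
  send σ _ := σ.val (activeColor q σ.round)
  step σ received :=
    ⟨σ.round + 1, σ.color, fun k ↦
      if k = activeColor q σ.round ∧ σ.val k = none then accepted (σ.color · = k) received
      else σ.val k⟩
  output σ := majority σ.val

lemma exists_activeColor_eq {q : ℕ} (k : Fin (2 ^ q)) (j : ℕ) :
    ∃ r, 2 ^ q * j ≤ r ∧ r < 2 ^ q * (j + 1) ∧ activeColor q r = k := by
  refine ⟨2 ^ q * j + k, Nat.le_add_right _ _, by rw [mul_add_one]; omega, Fin.ext ?_⟩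
  simp [activeColor, Nat.mod_eq_of_lt k.isLt]

section Values

variable {ι β : Type*} {m : β}

lemma exists_of_accepted_eq_some {P : ι → Prop} {received : ι → Option β}
    (h : accepted P received = some m) : ∃ w, P w ∧ received w = some m := by
  unfold accepted at h
  split_ifs at h with hex
  exact Option.some.inj h ▸ hex.choose_spec

lemma isSome_accepted {P : ι → Prop} {received : ι → Option β} {w : ι} (hw : P w)
    (hm : received w = some m) : (accepted P received).isSome := by
  rw [accepted, dif_pos ⟨m, w, hw, hm⟩, Option.isSome_some]

lemma majority_eq_some [Fintype ι] [DecidableEq β] {val : ι → Option β}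
    (h : Fintype.card ι < 2 * #{i | val i = some m}) : majority val = some m := by
  classical
  have hex : ∃ m, Fintype.card ι < 2 * #{i | val i = some m} := ⟨m, h⟩
  have hchoose : majority val = some hex.choose := dif_pos hex
  by_contra hne
  have hdisj : Disjoint (α := Finset ι) {i | val i = some m} {i | val i = some hex.choose} :=
    disjoint_filter.2 fun i _ hi hi' ↦ hne (by rw [hchoose, ← hi, hi'])
  have := hex.choose_spec
  have := card_union_of_disjoint hdisj
  have := card_le_univ <|
    ({i | val i = some m} : Finset ι) ∪ ({i | val i = some hex.choose} : Finset ι)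
  omega

lemma inbox_eq_some_iff {V : Type*} {idLen bw : ℕ} {id : V → Bits idLen} (hid : Injective id)
    {d : Traffic V bw} {v : V} {w : Bits idLen} {m : Bits bw} :
    inbox id d v w = some m ↔ ∃ u, id u = w ∧ d u v = some m := by
  by_cases hw : ∃ u, id u = w
  · obtain ⟨u, rfl⟩ := hw
    simp [inbox, hid.extend_apply, hid.eq_iff]
  · rw [inbox, extend_apply' _ _ _ hw]
    simp only [reduceCtorEq, false_iff]
    exact fun ⟨u, hu, _⟩ ↦ hw ⟨u, hu⟩

end Values

variable {V : Type*} [Fintype V] [DecidableEq V] {G : SimpleGraph V} [DecidableRel G.Adj]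
  {idLen msgLen q phases : ℕ} {id : V → Bits idLen} {s : V} {m₀ : Bits msgLen}
  {F : Finset (Sym2 V)} (adv : Strategy V (floodAlgorithm idLen msgLen q phases).coinLen msgLen)
  {ω : V → Bits (2 ^ idLen * q)}

variable (G id s m₀ F ω) in
/-- The state of node `v` after `r` rounds of the flooding algorithm. -/
noncomputable def floodState (r : ℕ) (v : V) : FloodState idLen msgLen q :=
  (run G id (floodAlgorithm idLen msgLen q phases) s m₀ F adv ω r).1 v

lemma floodState_round (r : ℕ) (v : V) : (floodState G id s m₀ F adv ω r v).round = r := by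
  induction r with
  | zero => rfl
  | succ _ ih => exact congrArg (· + 1) ih

lemma floodState_color (r : ℕ) (v : V) :
    (floodState G id s m₀ F adv ω r v).color = coinEquiv idLen q (ω v) := by
  induction r with
  | zero => rfl
  | succ _ ih => exact ih

variable (G id s m₀ F ω) in
/-- The messages that are delivered in round `r` of the flooding algorithm. -/
noncomputable def floodDelivered (r : ℕ) : Traffic V msgLen :=
  let A := floodAlgorithm idLen msgLen q phases
  let honest := sent G id A (floodState G id s m₀ F adv ω r)
  delivered F honest (adv ω ((run G id A s m₀ F adv ω r).2 ++ [honest]))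

lemma floodDelivered_of_notMem {u v : V} (h : s(u, v) ∉ F) (r : ℕ) :
    floodDelivered G id s m₀ F adv ω r u v =
      if G.Adj u v then (floodState G id s m₀ F adv ω r u).val (activeColor q r) else none := by
  calc floodDelivered G id s m₀ F adv ω r u v
      = if G.Adj u v then (floodState G id s m₀ F adv ω r u).val
          (activeColor q (floodState G id s m₀ F adv ω r u).round) else none := if_neg h
    _ = _ := by rw [floodState_round]

lemma floodState_succ_val (r : ℕ) (v : V) (k : Fin (2 ^ q)) :
    (floodState G id s m₀ F adv ω (r + 1) v).val k =
      if k = activeColor q r ∧ (floodState G id s m₀ F adv ω r v).val k = none then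
        accepted (coinEquiv idLen q (ω v) · = k) (inbox id (floodDelivered G id s m₀ F adv ω r) v)
      else (floodState G id s m₀ F adv ω r v).val k := by
  have hstep : (floodState G id s m₀ F adv ω (r + 1) v).val k =
      if k = activeColor q (floodState G id s m₀ F adv ω r v).round ∧
          (floodState G id s m₀ F adv ω r v).val k = none then
        accepted ((floodState G id s m₀ F adv ω r v).color · = k)
          (inbox id (floodDelivered G id s m₀ F adv ω r) v)
      else (floodState G id s m₀ F adv ω r v).val k := rfl
  rw [hstep, floodState_round, floodState_color]

lemma isFlooding_floodState (hid : Injective id) {k : Fin (2 ^ q)}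
    (hk : IsClean id F (coinEquiv idLen q ∘ ω) k) :
    IsFlooding G (Accepts id (coinEquiv idLen q ∘ ω) k) (activeColor q · = k) s m₀
      fun r v ↦ (floodState G id s m₀ F adv ω r v).val k where
  zero_source := if_pos rfl
  eq_of_zero h := by
    change (if _ then some m₀ else none) = _ at h
    split_ifs at h
    exact (Option.some.inj h).symm
  succ h := by rw [floodState_succ_val, if_neg (by simp [h]), h]
  eq_some_or_exists {r v m} h := by
    rw [floodState_succ_val] at h
    split_ifs at h with hactive
    · obtain ⟨w, hw, hm⟩ := exists_of_accepted_eq_some h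
      obtain ⟨u, rfl, hu⟩ := (inbox_eq_some_iff hid).1 hm
      rw [floodDelivered_of_notMem adv fun hF ↦ hk u v hF hw, ← hactive.1] at hu
      split_ifs at hu with huv
      exact .inr ⟨u, huv, hw, hu⟩
    · exact .inl h
  isSome_succ {r u v} hr huv hR h := by
    obtain ⟨m, hm⟩ := Option.isSome_iff_exists.1 h
    rw [floodState_succ_val]
    split_ifs with hactive
    · refine isSome_accepted hR (m := m) ((inbox_eq_some_iff hid).2 ⟨u, rfl, ?_⟩)
      rw [floodDelivered_of_notMem adv fun hF ↦ hk u v hF hR, if_pos huv, hr, hm]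
    · exact Option.isSome_iff_ne_none.2 fun hnone ↦ hactive ⟨hr.symm, hnone⟩

variable {adv}

lemma broadcastSucceeds_of_isSpreading (hid : Injective id) {φ : ℝ} (hφ : 0 < φ)
    (hG : IsExpander G φ) (hd : 0 < G.minDegree)
    (hphases : 32 * Real.log (Fintype.card V) / φ < phases) (hF : 4 * #F < 2 ^ q)
    (hspread : ∀ k, IsSpreading G (Accepts id (coinEquiv idLen q ∘ ω) k)) :
    BroadcastSucceeds G id (floodAlgorithm idLen msgLen q phases) s m₀ F adv ω := by
  classical
  intro v
  refine majority_eq_some ?_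
  have hsub : ({k | IsClean id F (coinEquiv idLen q ∘ ω) k} : Finset (Fin (2 ^ q))) ⊆
      ({k | (floodState G id s m₀ F adv ω (2 ^ q * phases) v).val k = some m₀} :
        Finset (Fin (2 ^ q))) :=
    monotone_filter_right _ fun k _ hk ↦
      (isFlooding_floodState adv hid hk).eq_some_of_isSpreading (hspread k) hφ hG hd
        (exists_activeColor_eq k) hphases v
  have hclean : #{k | IsClean id F (coinEquiv idLen q ∘ ω) k} +
      #{k | ¬ IsClean id F (coinEquiv idLen q ∘ ω) k} = 2 ^ q := by
    rw [card_filter_add_card_filter_not, card_univ, Fintype.card_fin]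
  have hunclean := card_not_isClean_le id F (coinEquiv idLen q ∘ ω)
  calc Fintype.card (Fin (2 ^ q))
      < 2 * #{k | IsClean id F (coinEquiv idLen q ∘ ω) k} := by
        rw [Fintype.card_fin]
        omega
    _ ≤ 2 * #{k | (floodState G id s m₀ F adv ω (2 ^ q * phases) v).val k = some m₀} := by
        gcongr
    _ = _ := rfl

lemma one_sub_le_successProb (hid : Injective id) {φ : ℝ} (hφ : 0 < φ) (hG : IsExpander G φ)
    (hphases : 32 * Real.log (Fintype.card V) / φ < phases) (hF : 4 * #F < 2 ^ q) {c : ℕ}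
    (hV : 2 ≤ Fintype.card V)
    (hdeg : 5 * ((c + 6 : ℕ) * Real.log (Fintype.card V)) * (2 ^ q : ℕ) ≤ φ * G.minDegree) :
    1 - 1 / (Fintype.card V : ℝ) ^ c ≤
      successProb G id (floodAlgorithm idLen msgLen q phases) s m₀ F adv := by
  have hlog : 0 < Real.log (Fintype.card V) := Real.log_pos (by exact_mod_cast hV)
  have hd : 0 < G.minDegree := by
    exact_mod_cast pos_of_mul_pos_right ((by positivity : (0 : ℝ) < _).trans_le hdeg) hφ.le
  have := isProbabilityMeasure_uniformOn (Set.finite_univ (α := V → Bits (2 ^ idLen * q)))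
    Set.univ_nonempty
  let bad : Set (V → Bits idLen → Fin (2 ^ q)) := {κ | ∃ k, ¬ IsSpreading G (Accepts id κ k)}
  let colors := Equiv.piCongrRight fun _ : V ↦ coinEquiv idLen q
  calc 1 - 1 / (Fintype.card V : ℝ) ^ c
      ≤ 1 - (uniformOn Set.univ).real bad := by
        gcongr
        exact hG.real_exists_not_isSpreading_le_one_div_pow hφ.le hd hid hV
          (by rwa [Fintype.card_fin])
    _ = 1 - (uniformOn Set.univ).real (colors ⁻¹' bad) := by
        rw [uniformOn_univ_real_preimage_equiv]
    _ = (uniformOn Set.univ).real (colors ⁻¹' bad)ᶜ :=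
        (probReal_compl_eq_one_sub (Set.toFinite _).measurableSet).symm
    _ ≤ successProb G id (floodAlgorithm idLen msgLen q phases) s m₀ F adv := by
        refine measureReal_mono (fun ω hω ↦ ?_) (measure_ne_top _ _)
        exact broadcastSucceeds_of_isSpreading hid hφ hG hd hphases hF fun k ↦
          not_not.1 fun hk ↦ hω ⟨k, hk⟩

end Algorithm

section Parameters

/-- The flooding algorithm with `Θ(t)` colors and with a number of phases that suffices when `N` is
a polynomial estimate of the number of nodes, with exponent `a`, and `ψ` a linear estimate of the
conductance, with factor `b`. -/
noncomputable def broadcastAlgorithm (a : ℕ) (b : ℝ) (N t : ℕ) (ψ : ℝ) :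
    Algorithm (a * Nat.clog 2 N) (a * Nat.clog 2 N) (a * Nat.clog 2 N) :=
  floodAlgorithm _ _ (Nat.clog 2 (4 * t + 1)) (⌊32 * (a * b * Real.log N / ψ)⌋₊ + 1)

lemma two_pow_clog_le {t : ℕ} (ht : 1 ≤ t) : 2 ^ Nat.clog 2 (4 * t + 1) ≤ 8 * t := by
  have hlt := Nat.pow_pred_clog_lt_self one_lt_two (x := 4 * t + 1) (by omega)
  have hpos : 0 < Nat.clog 2 (4 * t + 1) := Nat.clog_pos one_lt_two (by omega)
  rw [← Nat.succ_pred_eq_of_pos hpos, pow_succ]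
  omega

lemma log_le_mul_log_of_le_pow {m n a : ℕ} (h : m ≤ n ^ a) : Real.log m ≤ a * Real.log n := by
  rcases m.eq_zero_or_pos with rfl | hm
  · simpa using mul_nonneg a.cast_nonneg (Real.log_natCast_nonneg n)
  · rw [← Real.log_pow]
    exact Real.log_le_log (by exact_mod_cast hm) (by exact_mod_cast h)

lemma div_le_mul_div_of_le_mul {x y α b φ ψ : ℝ} (hx : 0 ≤ x) (hxy : x ≤ α * y) (hφ : 0 < φ)
    (hψ : 0 < ψ) (hψφ : ψ ≤ b * φ) : x / φ ≤ α * b * y / ψ := by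
  rw [div_le_div_iff₀ hφ hψ]
  calc x * ψ ≤ α * y * (b * φ) := mul_le_mul hxy hψφ hψ.le (hx.trans hxy)
    _ = α * b * y * φ := by ring

lemma rounds_broadcastAlgorithm_le {a N n t : ℕ} {b φ ψ : ℝ} (hn : 2 ≤ n) (ht : 1 ≤ t)
    (hφ : 0 < φ) (hφ1 : φ ≤ 1) (hψ : 0 < ψ) (hb : 0 ≤ b) (hNn : N ≤ n ^ a) (hφψ : φ ≤ b * ψ) :
    ((broadcastAlgorithm a b N t ψ).rounds : ℝ) ≤
      8 * (32 * (a * b) ^ 2 + 2) * (t * Real.log n / φ) := by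
  have hlogN : 0 ≤ Real.log N := Real.log_natCast_nonneg N
  have hphases : Real.log N / ψ ≤ a * b * Real.log n / φ :=
    div_le_mul_div_of_le_mul hlogN (log_le_mul_log_of_le_pow hNn) hψ hφ hφψ
  have hone : 1 ≤ 2 * Real.log n / φ := by
    rw [one_le_div₀ hφ]
    exact hφ1.trans (one_le_two_mul_log hn)
  calc ((broadcastAlgorithm a b N t ψ).rounds : ℝ)
      = (2 ^ Nat.clog 2 (4 * t + 1) : ℕ) * (⌊32 * (a * b * Real.log N / ψ)⌋₊ + 1) := by
        rw [← Nat.cast_add_one, ← Nat.cast_mul]; rfl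
    _ ≤ (8 * t : ℕ) * (32 * (a * b * Real.log N / ψ) + 1) := by
        gcongr
        exacts [two_pow_clog_le ht, Nat.floor_le (by positivity)]
    _ = (8 * t : ℕ) * (32 * (a * b) * (Real.log N / ψ) + 1) := by ring
    _ ≤ (8 * t : ℕ) * (32 * (a * b) * (a * b * Real.log n / φ) + 2 * Real.log n / φ) := by gcongr
    _ = 8 * (32 * (a * b) ^ 2 + 2) * (t * Real.log n / φ) := by push_cast; ring

lemma mul_log_div_le_mul_log_sq_div {n t : ℕ} (hn : 2 ≤ n) {φ : ℝ} (hφ : 0 < φ) :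
    t * Real.log n / φ ≤ 2 * (t * Real.log n ^ 2 / φ) := by
  calc t * Real.log n / φ ≤ t * Real.log n / φ * (2 * Real.log n) :=
        le_mul_of_one_le_right (by positivity) (one_le_two_mul_log hn)
    _ = 2 * (t * Real.log n ^ 2 / φ) := by ring

end Parameters

end AdvCongest

open AdvCongest in
theorem theorem3_general (a : ℕ) (b : ℝ) (c : ℕ) (hb : 0 ≤ b) :
    ∃ (C K : ℝ) (B : ℕ)
      (alg : (N t : ℕ) → (ψ : ℝ) →
        Algorithm (a * Nat.clog 2 N) (a * Nat.clog 2 N) (B * Nat.clog 2 N)),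
      0 < C ∧ 0 < K ∧
      ∀ {V : Type*} [Fintype V] [DecidableEq V] (n t N : ℕ) (φ ψ : ℝ) (G : SimpleGraph V)
        [DecidableRel G.Adj],
        Fintype.card V = n → 2 ≤ n → 1 ≤ t → 0 < φ →
        IsExpander G φ →
        C * (t * Real.log n / φ) ≤ (G.minDegree : ℝ) →
        n ≤ N ^ a → N ≤ n ^ a →
        φ ≤ b * ψ → ψ ≤ b * φ →
        ((alg N t ψ).rounds : ℝ) ≤ K * (t * Real.log n / φ) ∧
        ∀ (id : V → Bits (a * Nat.clog 2 N)), Function.Injective id →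
        ∀ (s : V) (m₀ : Bits (a * Nat.clog 2 N)) (F : Finset (Sym2 V)), F.card ≤ t →
        ∀ adv : Strategy V (alg N t ψ).coinLen (B * Nat.clog 2 N),
          1 - 1 / (n : ℝ) ^ c ≤ successProb G id (alg N t ψ) s m₀ F adv := by
  refine ⟨40 * (c + 6 : ℕ), 8 * (32 * (a * b) ^ 2 + 2), a, broadcastAlgorithm a b,
    by positivity, by positivity, ?_⟩
  rintro V _ _ _ t N φ ψ G _ rfl hn ht hφ hG hdeg hnN hNn hφψ hψφ
  have hlog : 0 < Real.log (Fintype.card V) := Real.log_pos (by exact_mod_cast hn)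
  have hψ : 0 < ψ := pos_of_mul_pos_right (hφ.trans_le hφψ) hb
  have hd : 0 < G.minDegree := by
    exact_mod_cast (by positivity : (0 : ℝ) < _).trans_le hdeg
  have : Nonempty V := Fintype.card_pos_iff.1 (by omega)
  refine ⟨rounds_broadcastAlgorithm_le hn ht hφ (hG.le_one hd) hψ hb hNn hφψ,
    fun id hid s m₀ F hF adv ↦ one_sub_le_successProb hid hφ hG ?_ ?_ hn ?_⟩
  · rw [mul_div_assoc 32, Nat.cast_add_one]
    refine lt_of_le_of_lt ?_ (Nat.lt_floor_add_one _)
    refine mul_le_mul_of_nonneg_left ?_ (by norm_num)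
    exact div_le_mul_div_of_le_mul hlog.le (log_le_mul_log_of_le_pow hnN) hφ hψ hψφ
  · have := Nat.le_pow_clog one_lt_two (4 * t + 1)
    omega
  · calc 5 * ((c + 6 : ℕ) * Real.log (Fintype.card V)) * (2 ^ Nat.clog 2 (4 * t + 1) : ℕ)
        ≤ 5 * ((c + 6 : ℕ) * Real.log (Fintype.card V)) * (8 * t : ℕ) := by
          gcongr
          exact two_pow_clog_le ht
      _ = φ * (40 * (c + 6 : ℕ) * (t * Real.log (Fintype.card V) / φ)) := by
          push_cast
          field_simp
          ring
      _ ≤ φ * G.minDegree := by gcongr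

open AdvCongest in
/-- Constants: `a` for the polynomial estimate of `n` and the `O(log n)` length of identifiers and
of the broadcast message, `b` for the linear estimate of `φ`, `c` for "with high probability".
The nodes know `N`, `t` and `ψ` (estimates of `n` and `φ`, and the bound on the number of
adversarial edges), but not the graph. -/
theorem theorem3 (a : ℕ) (b : ℝ) (c : ℕ) (ha : 1 ≤ a) (hb : 1 ≤ b) :
    ∃ (C K : ℝ) (B : ℕ)
      (alg : (N t : ℕ) → (ψ : ℝ) →
        Algorithm (a * Nat.clog 2 N) (a * Nat.clog 2 N) (B * Nat.clog 2 N)),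
      0 < C ∧ 0 < K ∧
      ∀ (n t N : ℕ) (φ ψ : ℝ) (G : SimpleGraph (Fin n)) [DecidableRel G.Adj],
        2 ≤ n → 1 ≤ t → 0 < φ →
        IsExpander G φ →
        C * ((t : ℝ) ^ 2 * Real.log n / φ) ≤ (G.minDegree : ℝ) →
        n ≤ N ^ a → N ≤ n ^ a →
        φ ≤ b * ψ → ψ ≤ b * φ →
        ((alg N t ψ).rounds : ℝ) ≤ K * (t * Real.log n ^ 2 / φ) ∧
        ∀ (id : Fin n → Bits (a * Nat.clog 2 N)), Function.Injective id →
        ∀ (s : Fin n) (m₀ : Bits (a * Nat.clog 2 N)) (F : Finset (Sym2 (Fin n))),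
          F ⊆ G.edgeFinset → F.card ≤ t →
        ∀ adv : Strategy (Fin n) (alg N t ψ).coinLen (B * Nat.clog 2 N),
          1 - 1 / (n : ℝ) ^ c ≤ successProb G id (alg N t ψ) s m₀ F adv := by
  obtain ⟨C, K, B, alg, hC, hK, h⟩ := theorem3_general a b c (zero_le_one.trans hb)
  refine ⟨C, K * 2, B, alg, hC, by positivity,
    fun n t N φ ψ G _ hn ht hφ hG hdeg hnN hNn hφψ hψφ ↦ ?_⟩
  refine (h n t N φ ψ G (Fintype.card_fin n) hn ht hφ hG (le_trans ?_ hdeg) hnN hNn hφψ hψφ).imp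
    (·.trans ?_) fun hsucc id hid s m₀ F _ ↦ hsucc id hid s m₀ F
  · gcongr
    exact_mod_cast Nat.le_self_pow two_ne_zero t
  · rw [mul_assoc]
    gcongr
    exact mul_log_div_le_mul_log_sq_div hn hφ
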